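/- A word is a finite sequence $w=(w_1,\dots,w_n)\in\{0,1\}^n$, and a word property is a set of words. For $I=\{i_1<\dots<i_\ell\}\subseteq[n]$ let $\mathrm{sub}(I,w)=(w_{i_1},\dots,w_{i_\ell})$, and for $1\le\ell\le n$ let $\mathrm{sub}(\ell,w)$ be the random word $\mathrm{sub}(I,w)$ with $I$ chosen uniformly among all $\ell$-element subsets of $[n]$. For $w\in\{0,1\}^n$ and a word property $\mathcal P$ let $d_1(w,\mathcal P)=\min_{u\in\mathcal P\cap\{0,1\}^n}\frac1n\sum_{i=1}^n|w_i-u_i|$, with $d_1(w,\mathcal P)=\infty$ if $\mathcal P\cap\{0,1\}^n=\emptyset$. Call $\mathcal P$ hereditary if $\mathrm{sub}(I,w)\in\mathcal P$ for every $w\in\mathcal P$ of length $n$ and every $I\subseteq[n]$. **Theorem.** Every hereditary word property $\mathcal P$ is testable with perfect completeness; that is, there is a word property $\mathcal P'$ such that - (perfect completeness) for every $w\in\mathcal P$ of length $n$ and every $1\le\ell\le n$, $\mathbb P(\mathrm{sub}(\ell,w)\in\mathcal P')=1$; - (soundness) for every $\varepsilon>0$ there is an integer $\ell(\varepsilon)\ge1$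 such that for every $n$ and every $w\in\{0,1\}^n$ with $d_1(w,\mathcal P)\ge\varepsilon$, and for all $\ell(\varepsilon)\le\ell\le n$, $\mathbb P(\mathrm{sub}(\ell,w)\in\mathcal P')\le\frac13$. -/

import Mathlib

/-- Words of length `n` over the alphabet `{0, 1}`. -/
abbrev Word (n : ℕ) : Type := Fin n → Fin 2

/-- A word property is a collection of words; `P n` is its set of members of length `n`. -/
abbrev WordProperty : Type := ∀ n : ℕ, Set (Word n)

/-- `sub I w` is the subsequence of `w` formed by the letters at the positions in `I`, read in
increasing order of position. -/
def Word.sub {n : ℕ} (I : Finset (Fin n)) (w : Word n) : Word I.card :=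
  fun k => w (I.orderEmbOfFin rfl k)

/-- A word property is hereditary if it contains every subsequence of each of its members. -/
def WordProperty.IsHereditary (P : WordProperty) : Prop :=
  ∀ (n : ℕ) (w : Word n), w ∈ P n → ∀ I : Finset (Fin n), Word.sub I w ∈ P I.card

open scoped Classical in
/-- The probability that `sub I w` belongs to `Q`, where `I` is chosen uniformly at random among
the `ℓ`-element sets of positions of `w` (meaningful for `ℓ ≤ n`, when such sets exist). -/
noncomputable def Word.probSub {n : ℕ} (ℓ : ℕ) (w : Word n) (Q : WordProperty) : ℝ :=
  (((Finset.univ.powersetCard ℓ).filter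
      (fun I : Finset (Fin n) => Word.sub I w ∈ Q I.card)).card : ℝ) /
    ((Finset.univ.powersetCard ℓ : Finset (Finset (Fin n))).card : ℝ)

/-- The normalized Hamming distance of two words of the same length. -/
noncomputable def Word.d₁ {n : ℕ} (w u : Word n) : ℝ :=
  (1 / (n : ℝ)) * ∑ i : Fin n, |((w i : ℕ) : ℝ) - ((u i : ℕ) : ℝ)|

/-- The distance of a word of length `n` to a word property: the least distance to a member of
length `n`, and `∞` if there is no such member. -/
noncomputable def Word.distTo {n : ℕ} (w : Word n) (P : WordProperty) : ENNReal :=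
  ⨅ u ∈ P n, ENNReal.ofReal (Word.d₁ w u)

/-- Completeness with probability `c`: a random subsequence of any length `1 ≤ ℓ ≤ n` of a word of
length `n` in `P` belongs to `P'` with probability at least `c`. -/
def WordProperty.Completeness (c : ℝ) (P P' : WordProperty) : Prop :=
  ∀ (n : ℕ) (w : Word n), w ∈ P n → ∀ ℓ : ℕ, 1 ≤ ℓ → ℓ ≤ n → c ≤ Word.probSub ℓ w P'

/-- Soundness: for every `ε > 0` there is a length `ℓ₀ = ℓ(ε)` such that random subsequences of
length at least `ℓ₀` of a word at distance at least `ε` from `P` belong to `P'` with probability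
at most `1/3`. -/
def WordProperty.Soundness (P P' : WordProperty) : Prop :=
  ∀ ε : ℝ, 0 < ε → ∃ ℓ₀ : ℕ, 1 ≤ ℓ₀ ∧
    ∀ (n : ℕ) (w : Word n), ENNReal.ofReal ε ≤ Word.distTo w P →
      ∀ ℓ : ℕ, ℓ₀ ≤ ℓ → ℓ ≤ n → Word.probSub ℓ w P' ≤ 1 / 3

/-- `P` is testable if it has a test property `P'` with completeness `2/3`. -/
def WordProperty.IsTestable (P : WordProperty) : Prop :=
  ∃ P' : WordProperty, WordProperty.Completeness (2 / 3) P P' ∧ WordProperty.Soundness P P'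

/-- `P` is testable with perfect completeness if completeness holds with probability `1`. -/
def WordProperty.IsTestableWithPerfectCompleteness (P : WordProperty) : Prop :=
  ∃ P' : WordProperty, WordProperty.Completeness 1 P P' ∧ WordProperty.Soundness P P'

/-!
A hereditary property `P` is tested by itself. Completeness is heredity.

For soundness, say that `w` *robustly contains* `v` at scale `c` (`Word.RobustlyContains`) if there
are sets of positions `S₀ < S₁ < ⋯`, one for each letter of `v`, each with at least `c * n`
elements, such that `w` is constantly `v i` on `S i`. A random set of `ℓ` positions misses a given
`S i` with probability at most `(1 - c) ^ ℓ`, and when it meets all of them its subsequence contains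
`v`. So if `v ∉ P`, the subsequence is in `P` with probability at most `|v| * (1 - c) ^ ℓ`
(`Word.probSub_le_of_robustlyContains`). It remains to find, in every word `w` that is `ε`-far from
`P`, a robustly contained word outside `P`, with length and scale depending on `P` and `ε` only.

If `P` contains all words, no word is far from it. Otherwise fix a word `u ∉ P` of some length `M`.
Cut `w` into `N` consecutive blocks, with `N` large in terms
of `M` and `ε`. If there are `M` blocks in which both letters have positive density, then `u` is
robustly contained, one letter per block (`Word.robustlyContains_of_mixed_blocks`). Otherwise almost
every block is nearly constant, so `w` is `ε`-close to the word which is constant on each block and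
takes there the majority letter; this word is therefore not in `P`. It is a subsequence of every
large blow-up of the pattern `τ` of the `N` majority letters, so some blow-up of `τ` is not in `P`,
and `w` robustly contains this blow-up (`Word.robustlyContains_blowUp`). As there are only finitely
many patterns of length `N`, the sizes of these blow-ups are bounded.
-/

/-! ### Hereditary properties and blow-ups -/

theorem WordProperty.IsHereditary.comp_mem {P : WordProperty} (hP : P.IsHereditary) {n L : ℕ}
    {w : Word n} (hw : w ∈ P n) (g : Fin L → Fin n) (hg : StrictMono g) : w ∘ g ∈ P L := by
  have key : ∀ (I : Finset (Fin n)) (L : ℕ) (h : I.card = L),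
      (fun k => w (I.orderEmbOfFin h k)) ∈ P L := by
    intro I L h
    subst h
    exact hP n w hw I
  have hc : (Finset.univ.image g).card = L := by
    rw [Finset.card_image_of_injective _ hg.injective, Finset.card_fin]
  have h := key _ L hc
  rwa [← Finset.orderEmbOfFin_unique hc (fun x => Finset.mem_image_of_mem g (Finset.mem_univ x)) hg]
    at h

/-- The word obtained from `τ` by repeating each letter `m` times. -/
def Word.blowUp {N : ℕ} (τ : Word N) (m : ℕ) : Word (N * m) := fun k => τ k.divNat

/-- A word of length `n` that runs monotonically through the letters of `τ`, possibly skipping some,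
is a subsequence of the `n`-fold blow-up of `τ`. -/
theorem WordProperty.IsHereditary.comp_monotone_mem {P : WordProperty} (hP : P.IsHereditary)
    {n N : ℕ} {τ : Word N} (hτ : τ.blowUp n ∈ P (N * n)) (b : Fin n → Fin N) (hb : Monotone b) :
    τ ∘ b ∈ P n := by
  have hlt : ∀ p : Fin n, (b p : ℕ) * n + p < N * n := by
    intro p
    have h1 : ((b p : ℕ) + 1) * n ≤ N * n := Nat.mul_le_mul_right _ (b p).2
    have h2 := p.2
    rw [add_mul, one_mul] at h1
    omega
  have h := hP.comp_mem hτ (fun p => ⟨(b p : ℕ) * n + p, hlt p⟩) (by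
    intro p p' hpp
    have h1 : (b p : ℕ) * n ≤ b p' * n := Nat.mul_le_mul_right _ (hb hpp.le)
    have h2 : (p : ℕ) < p' := hpp
    exact Fin.mk_lt_mk.2 (by omega))
  convert h using 1
  funext p
  have hn : 0 < n := p.pos
  simp only [Function.comp, Word.blowUp]
  congr 1
  apply Fin.ext
  simp only [Fin.coe_divNat]
  rw [mul_comm, Nat.mul_add_div hn, Nat.div_eq_of_lt p.2, add_zero]

/-! ### Robust containment and random subsequences -/

/-- `w` robustly contains `v` at scale `c` if there are sets of at least `c * n` positions of `w`,
one for each letter of `v` and in the same order, such that every choice of one position from each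
set spells `v`. -/
def Word.RobustlyContains {n L : ℕ} (c : ℝ) (w : Word n) (v : Word L) : Prop :=
  ∃ S : Fin L → Finset (Fin n), (∀ i, c * n ≤ (S i).card) ∧ (∀ i, ∀ p ∈ S i, w p = v i) ∧
    ∀ i j, i < j → ∀ a ∈ S i, ∀ b ∈ S j, a < b

theorem Nat.descFactorial_mul_pow_le {a n : ℕ} (h : a ≤ n) (ℓ : ℕ) :
    a.descFactorial ℓ * n ^ ℓ ≤ a ^ ℓ * n.descFactorial ℓ := by
  induction ℓ with
  | zero => simp
  | succ k ih =>
    have h1 : (a - k) * n ≤ a * (n - k) := by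
      rw [Nat.sub_mul, Nat.mul_sub]
      have : k * a ≤ k * n := Nat.mul_le_mul_left _ h
      rw [mul_comm a k]
      omega
    rw [Nat.descFactorial_succ, Nat.descFactorial_succ, pow_succ, pow_succ]
    calc (a - k) * a.descFactorial k * (n ^ k * n)
        = ((a - k) * n) * (a.descFactorial k * n ^ k) := by ring
      _ ≤ (a * (n - k)) * (a ^ k * n.descFactorial k) := Nat.mul_le_mul h1 ih
      _ = a ^ k * a * ((n - k) * n.descFactorial k) := by ring

theorem Nat.choose_mul_pow_le {a n : ℕ} (h : a ≤ n) (ℓ : ℕ) :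
    a.choose ℓ * n ^ ℓ ≤ a ^ ℓ * n.choose ℓ := by
  have := Nat.descFactorial_mul_pow_le h ℓ
  rw [Nat.descFactorial_eq_factorial_mul_choose, Nat.descFactorial_eq_factorial_mul_choose] at this
  refine Nat.le_of_mul_le_mul_left ?_ (Nat.factorial_pos ℓ)
  calc _ = _ := by ring
    _ ≤ _ := this
    _ = _ := by ring

/-- A random `ℓ`-element set of positions misses a set of at least `c * n` positions with
probability at most `(1 - c) ^ ℓ`. -/
theorem card_powersetCard_disjoint_le {n : ℕ} (S : Finset (Fin n)) {c : ℝ}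
    (hS : c * n ≤ S.card) (ℓ : ℕ) :
    (((Finset.univ.powersetCard ℓ).filter (fun I : Finset (Fin n) => Disjoint I S)).card : ℝ)
      ≤ (1 - c) ^ ℓ * n.choose ℓ := by
  have h1 : (Finset.univ.powersetCard ℓ).filter (fun I : Finset (Fin n) => Disjoint I S)
      = Sᶜ.powersetCard ℓ := by
    ext I
    simp only [Finset.mem_filter, Finset.mem_powersetCard, Finset.subset_univ, true_and,
      ← Finset.subset_compl_iff_disjoint_right]
    tauto
  rw [h1, Finset.card_powersetCard, Finset.card_compl, Fintype.card_fin]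
  rcases Nat.eq_zero_or_pos n with hn | hn
  · subst hn
    rcases Nat.eq_zero_or_pos ℓ with hl | hl
    · simp [hl]
    · simp [Nat.choose_eq_zero_of_lt hl]
  have hn' : (0 : ℝ) < n := by exact_mod_cast hn
  have hcard : S.card ≤ n := by simpa using S.card_le_univ
  have h2 : ((n - S.card : ℕ) : ℝ) ≤ (1 - c) * n := by
    rw [Nat.cast_sub hcard]
    linarith
  have h3 : ((n - S.card).choose ℓ : ℝ) * (n : ℝ) ^ ℓ
      ≤ ((n - S.card : ℕ) : ℝ) ^ ℓ * n.choose ℓ := by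
    exact_mod_cast Nat.choose_mul_pow_le (Nat.sub_le n S.card) ℓ
  have h4 : ((n - S.card : ℕ) : ℝ) ^ ℓ ≤ ((1 - c) * n) ^ ℓ :=
    pow_le_pow_left₀ (Nat.cast_nonneg _) h2 ℓ
  refine le_of_mul_le_mul_right ?_ (pow_pos hn' ℓ)
  calc _ ≤ _ := h3
    _ ≤ ((1 - c) * n) ^ ℓ * n.choose ℓ := by gcongr
    _ = _ := by rw [mul_pow]; ring

theorem WordProperty.IsHereditary.mem_of_sub_mem {P : WordProperty} (hP : P.IsHereditary)
    {n L : ℕ} {w : Word n} {v : Word L} {I : Finset (Fin n)} (hI : Word.sub I w ∈ P I.card)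
    (g : Fin L → Fin n) (hg : StrictMono g) (hgI : ∀ i, g i ∈ I) (hgv : ∀ i, w (g i) = v i) :
    v ∈ P L := by
  have h := hP.comp_mem hI (fun i => (I.orderIsoOfFin rfl).symm ⟨g i, hgI i⟩)
    (fun i j hij => (I.orderIsoOfFin rfl).symm.strictMono (hg hij))
  convert h using 1
  funext i
  simp only [Function.comp, Word.sub, ← Finset.coe_orderIsoOfFin_apply, OrderIso.apply_symm_apply,
    hgv]

theorem Word.probSub_le_of_robustlyContains {P : WordProperty} (hP : P.IsHereditary) {n L : ℕ}
    {c : ℝ} {w : Word n} {v : Word L} (h : w.RobustlyContains c v) (hv : v ∉ P L) {ℓ : ℕ}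
    (hℓ : ℓ ≤ n) : Word.probSub ℓ w P ≤ L * (1 - c) ^ ℓ := by
  classical
  obtain ⟨S, hcard, hval, hord⟩ := h
  unfold Word.probSub
  have hpos : (0 : ℝ) < ((Finset.univ.powersetCard ℓ : Finset (Finset (Fin n))).card : ℝ) := by
    rw [Finset.card_powersetCard, Finset.card_fin]
    exact_mod_cast Nat.choose_pos hℓ
  rw [div_le_iff₀ hpos, Finset.card_powersetCard, Finset.card_fin]
  -- a set of positions meeting every `S i` spells a word containing `v`
  have hsub : (Finset.univ.powersetCard ℓ).filter
      (fun I : Finset (Fin n) => Word.sub I w ∈ P I.card) ⊆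
      Finset.univ.biUnion (fun i => (Finset.univ.powersetCard ℓ).filter
        (fun I : Finset (Fin n) => Disjoint I (S i))) := by
    intro I hI
    rw [Finset.mem_filter] at hI
    simp only [Finset.mem_biUnion, Finset.mem_univ, true_and, Finset.mem_filter]
    by_contra! hcon
    have hmeet : ∀ i, ∃ p, p ∈ I ∧ p ∈ S i := fun i =>
      Finset.not_disjoint_iff.1 (hcon i hI.1)
    choose g hgI hgS using hmeet
    exact hv (hP.mem_of_sub_mem hI.2 g (fun i j hij => hord i j hij _ (hgS i) _ (hgS j)) hgI
      (fun i => hval i _ (hgS i)))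
  calc _ ≤ ((Finset.univ.biUnion (fun i => (Finset.univ.powersetCard ℓ).filter
        (fun I : Finset (Fin n) => Disjoint I (S i)))).card : ℝ) := by
        exact_mod_cast Finset.card_le_card (by convert hsub)
    _ ≤ ∑ i, (((Finset.univ.powersetCard ℓ).filter
        (fun I : Finset (Fin n) => Disjoint I (S i))).card : ℝ) := by
        exact_mod_cast Finset.card_biUnion_le
    _ ≤ ∑ _i : Fin L, (1 - c) ^ ℓ * (n.choose ℓ : ℝ) :=
        Finset.sum_le_sum (fun i _ => card_powersetCard_disjoint_le (S i) (hcard i) ℓ)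
    _ = L * (1 - c) ^ ℓ * n.choose ℓ := by simp [mul_assoc]

/-! ### Blocks of a word -/

/-- The positions with letter `a` in the `i`-th of the consecutive blocks of length `q`. -/
def Word.blockLetter {n : ℕ} (w : Word n) (q i : ℕ) (a : Fin 2) : Finset (Fin n) :=
  Finset.univ.filter (fun p => (p : ℕ) / q = i ∧ w p = a)

theorem Word.mem_blockLetter {n : ℕ} {w : Word n} {q i : ℕ} {a : Fin 2} {p : Fin n} :
    p ∈ w.blockLetter q i a ↔ (p : ℕ) / q = i ∧ w p = a := by
  simp [Word.blockLetter]

theorem Word.lt_of_mem_blockLetter {n : ℕ} {w : Word n} {q i j : ℕ} {a b : Fin 2} {p p' : Fin n}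
    (hp : p ∈ w.blockLetter q i a) (hp' : p' ∈ w.blockLetter q j b) (hij : i < j) : p < p' := by
  rw [Word.mem_blockLetter] at hp hp'
  by_contra! hle
  have : (p' : ℕ) / q ≤ p / q := Nat.div_le_div_right hle
  omega

theorem Word.card_blockLetter_add {n N q : ℕ} (w : Word n) (h0 : 0 < q) (hq : N * q ≤ n)
    {i : ℕ} (hi : i < N) :
    (w.blockLetter q i 0).card + (w.blockLetter q i 1).card = q := by
  have hdisj : Disjoint (w.blockLetter q i 0) (w.blockLetter q i 1) := by
    rw [Finset.disjoint_left]
    intro p hp hp'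
    rw [Word.mem_blockLetter] at hp hp'
    exact absurd (hp.2.symm.trans hp'.2) (by decide)
  rw [← Finset.card_union_of_disjoint hdisj]
  have hlt : ∀ k : Fin q, i * q + k < n := by
    intro k
    have h1 : (i + 1) * q ≤ N * q := Nat.mul_le_mul_right _ hi
    have h2 := k.2
    rw [add_mul, one_mul] at h1
    omega
  have himg : w.blockLetter q i 0 ∪ w.blockLetter q i 1
      = Finset.univ.image (fun k : Fin q => (⟨i * q + k, hlt k⟩ : Fin n)) := by
    ext p
    simp only [Finset.mem_union, Word.mem_blockLetter, Finset.mem_image, Finset.mem_univ, true_and]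
    constructor
    · intro h
      have hd : (p : ℕ) / q = i := h.elim And.left And.left
      refine ⟨⟨p % q, Nat.mod_lt _ h0⟩, Fin.ext ?_⟩
      subst hd
      exact Nat.div_add_mod' _ _
    · rintro ⟨k, rfl⟩
      have : (i * q + k) / q = i := by
        rw [mul_comm, Nat.mul_add_div h0, Nat.div_eq_of_lt k.2, add_zero]
      have h2 : ∀ a : Fin 2, a = 0 ∨ a = 1 := by decide
      exact (h2 (w ⟨i * q + k, hlt k⟩)).imp (fun h => ⟨this, h⟩) (fun h => ⟨this, h⟩)
  rw [himg, Finset.card_image_of_injective, Finset.card_fin]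
  intro k k' hk
  have := congrArg Fin.val hk
  exact Fin.ext (by simpa using this)

theorem Word.robustlyContains_of_mixed_blocks {n M q : ℕ} {c : ℝ} (w : Word n) (u : Word M)
    (B : Finset ℕ) (hM : M ≤ B.card)
    (hB : ∀ i ∈ B, ∀ a, c * n ≤ (w.blockLetter q i a).card) : w.RobustlyContains c u := by
  refine ⟨fun j => w.blockLetter q (B.orderEmbOfFin rfl (Fin.castLE hM j)) (u j), fun j => ?_,
    fun j p hp => (Word.mem_blockLetter.1 hp).2, fun j k hjk a ha b hb => ?_⟩
  · exact hB _ (Finset.orderEmbOfFin_mem _ _ _) _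
  · exact Word.lt_of_mem_blockLetter ha hb
      ((B.orderEmbOfFin rfl).strictMono ((Fin.strictMono_castLE hM) hjk))

theorem Finset.exists_ordered_split {n : ℕ} (S : Finset (Fin n)) {m r : ℕ} (h : m * r ≤ S.card) :
    ∃ T : Fin m → Finset (Fin n), (∀ j, T j ⊆ S) ∧ (∀ j, (T j).card = r) ∧
      ∀ i j, i < j → ∀ a ∈ T i, ∀ b ∈ T j, a < b := by
  have hlt : ∀ (j : Fin m) (k : Fin r), (j : ℕ) * r + k < S.card := by
    intro j k
    have h1 : ((j : ℕ) + 1) * r ≤ m * r := Nat.mul_le_mul_right _ j.2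
    have h2 := k.2
    rw [add_mul, one_mul] at h1
    omega
  refine ⟨fun j => Finset.univ.image (fun k : Fin r => S.orderEmbOfFin rfl ⟨j * r + k, hlt j k⟩),
    fun j => ?_, fun j => ?_, fun i j hij a ha b hb => ?_⟩
  · intro p hp
    obtain ⟨k, -, rfl⟩ := Finset.mem_image.1 hp
    exact Finset.orderEmbOfFin_mem _ _ _
  · rw [Finset.card_image_of_injective, Finset.card_fin]
    intro k k' hk
    have := congrArg Fin.val ((S.orderEmbOfFin rfl).injective hk)
    exact Fin.ext (by simpa using this)
  · obtain ⟨k, -, rfl⟩ := Finset.mem_image.1 ha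
    obtain ⟨k', -, rfl⟩ := Finset.mem_image.1 hb
    refine (S.orderEmbOfFin rfl).strictMono (Fin.mk_lt_mk.2 ?_)
    have h1 : ((i : ℕ) + 1) * r ≤ j * r := Nat.mul_le_mul_right _ hij
    have h2 := k.2
    rw [add_mul, one_mul] at h1
    omega

theorem Word.robustlyContains_blowUp {n N q m r : ℕ} {c : ℝ} (w : Word n) (τ : Word N)
    (hτ : ∀ i : Fin N, m * r ≤ (w.blockLetter q i (τ i)).card) (hr : c * n ≤ r) :
    w.RobustlyContains c (τ.blowUp m) := by
  choose T hTS hTc hTo using fun i => Finset.exists_ordered_split _ (hτ i)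
  refine ⟨fun k => T k.divNat k.modNat, fun k => by rw [hTc]; exact hr,
    fun k p hp => (Word.mem_blockLetter.1 (hTS _ _ hp)).2, fun k k' hk a ha b hb => ?_⟩
  have hle : (k : ℕ) / m ≤ k' / m := Nat.div_le_div_right hk.le
  rcases hle.lt_or_eq with hlt | heq
  · exact Word.lt_of_mem_blockLetter (hTS _ _ ha) (hTS _ _ hb) hlt
  · have hdiv : k.divNat = k'.divNat := Fin.ext heq
    have hb : b ∈ T k'.divNat k'.modNat := hb
    rw [← hdiv] at hb
    refine hTo _ _ _ (show (k : ℕ) % m < k' % m from ?_) a ha b hb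
    have h1 := Nat.div_add_mod (k : ℕ) m
    have h2 := Nat.div_add_mod (k' : ℕ) m
    have h3 : (k : ℕ) < k' := hk
    rw [heq] at h1
    omega

/-! ### Distance to a blockwise constant word -/

theorem Word.exists_majority {n N q : ℕ} (w : Word n) (h0 : 0 < q)
    (hq : N * q ≤ n) :
    ∃ τ : Word N, ∀ i : Fin N, q ≤ 2 * (w.blockLetter q i (τ i)).card ∧
      ∀ a, (w.blockLetter q i (1 - τ i)).card ≤ (w.blockLetter q i a).card := by
  have key : ∀ i : Fin N, ∃ t : Fin 2, q ≤ 2 * (w.blockLetter q i t).card ∧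
      ∀ a, (w.blockLetter q i (1 - t)).card ≤ (w.blockLetter q i a).card := by
    intro i
    have h := w.card_blockLetter_add h0 hq i.2
    rcases le_total (w.blockLetter q i 0).card (w.blockLetter q i 1).card with h1 | h1
    · refine ⟨1, by omega, fun a => ?_⟩
      fin_cases a
      · exact le_rfl
      · exact h1
    · refine ⟨0, by omega, fun a => ?_⟩
      fin_cases a
      · exact h1
      · exact le_rfl
  choose τ hτ using key
  exact ⟨τ, hτ⟩

theorem Word.d₁_le_card_ne {n : ℕ} (w u : Word n) :
    w.d₁ u ≤ (Finset.univ.filter (fun p => w p ≠ u p)).card / n := by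
  have hletter : ∀ a b : Fin 2, |((a : ℕ) : ℝ) - ((b : ℕ) : ℝ)| ≤ if a ≠ b then 1 else 0 := by
    intro a b
    fin_cases a <;> fin_cases b <;> simp
  unfold Word.d₁
  rw [one_div, div_eq_inv_mul _ (n : ℝ)]
  refine mul_le_mul_of_nonneg_left ?_ (by positivity)
  calc _ ≤ ∑ p : Fin n, (if w p ≠ u p then (1 : ℝ) else 0) :=
        Finset.sum_le_sum (fun p _ => hletter _ _)
    _ = _ := by rw [Finset.sum_boole]

/-- The block of a position, among `N` blocks of length `q`; the positions beyond the last block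
are counted to it. -/
def blockIndex {n N : ℕ} (hN : 0 < N) (q : ℕ) (p : Fin n) : Fin N :=
  ⟨min ((p : ℕ) / q) (N - 1), by omega⟩

theorem blockIndex_monotone {n N : ℕ} (hN : 0 < N) (q : ℕ) :
    Monotone (blockIndex hN q : Fin n → Fin N) := by
  intro p p' h
  have : (p : ℕ) / q ≤ p' / q := Nat.div_le_div_right h
  exact Fin.mk_le_mk.2 (by omega)

/-- A word differs from the pattern `τ` only at the letters other than `τ i` in the `i`-th block, and
perhaps at the fewer than `N` positions beyond the last block. -/
theorem Word.card_ne_pattern_le {n N : ℕ} (hN : 0 < N) (hNn : N ≤ n) (w : Word n) (τ : Word N) :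
    (Finset.univ.filter (fun p => w p ≠ (τ ∘ blockIndex hN (n / N)) p)).card
      ≤ ∑ i : Fin N, (w.blockLetter (n / N) i (1 - τ i)).card + N := by
  have hq : 0 < n / N := Nat.div_pos hNn hN
  have hsub : Finset.univ.filter (fun p => w p ≠ (τ ∘ blockIndex hN (n / N)) p) ⊆
      (Finset.univ.biUnion fun i : Fin N => w.blockLetter (n / N) i (1 - τ i)) ∪
        Finset.univ.filter (fun p : Fin n => N * (n / N) ≤ (p : ℕ)) := by
    intro p hp
    simp only [Finset.mem_filter, Finset.mem_univ, true_and, Function.comp] at hp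
    simp only [Finset.mem_union, Finset.mem_biUnion, Finset.mem_filter, Finset.mem_univ, true_and,
      Word.mem_blockLetter]
    by_cases h : N * (n / N) ≤ (p : ℕ)
    · exact Or.inr h
    · left
      have hlt : (p : ℕ) / (n / N) < N := (Nat.div_lt_iff_lt_mul hq).2 (by omega)
      have hflip : ∀ a b : Fin 2, a ≠ b → a = 1 - b := by decide
      have hidx : blockIndex hN (n / N) p = ⟨(p : ℕ) / (n / N), hlt⟩ :=
        Fin.ext (by simp only [blockIndex]; omega)
      rw [hidx] at hp
      exact ⟨_, rfl, hflip _ _ hp⟩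
  have hrest : (Finset.univ.filter (fun p : Fin n => N * (n / N) ≤ (p : ℕ))).card ≤ N := by
    calc _ = ((Finset.univ.filter (fun p : Fin n => N * (n / N) ≤ (p : ℕ))).map
          Fin.valEmbedding).card := (Finset.card_map _).symm
      _ ≤ (Finset.Ico (N * (n / N)) n).card := by
          refine Finset.card_le_card fun x hx => ?_
          obtain ⟨p, hp, rfl⟩ := Finset.mem_map.1 hx
          exact Finset.mem_Ico.2 ⟨(Finset.mem_filter.1 hp).2, p.2⟩
      _ ≤ N := by
          rw [Nat.card_Ico]
          have h1 := Nat.div_add_mod n N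
          have h2 := Nat.mod_lt n hN
          omega
  calc _ ≤ _ := Finset.card_le_card hsub
    _ ≤ _ := Finset.card_union_le _ _
    _ ≤ _ := Nat.add_le_add Finset.card_biUnion_le hrest

theorem Word.notMem_of_d₁_lt {P : WordProperty} {n : ℕ} {w u : Word n} {ε : ℝ}
    (hw : ENNReal.ofReal ε ≤ w.distTo P) (hε : 0 < ε) (hu : w.d₁ u < ε) : u ∉ P n := by
  intro hmem
  have h1 : w.distTo P ≤ ENNReal.ofReal (w.d₁ u) := iInf₂_le u hmem
  exact absurd (hw.trans h1) (not_le.2 ((ENNReal.ofReal_lt_ofReal_iff hε).2 hu))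

/-! ### Words far from a hereditary property -/

/-- If at most `M` blocks have an `ε / 4` proportion of letters other than the one that `τ`
prescribes, then the pattern `τ` is `ε`-close to the word. -/
theorem Word.d₁_pattern_lt {n N M : ℕ} {ε : ℝ} (hε : 0 < ε) (hN : 0 < N) (hNn : N ≤ n)
    (hMN : M ≤ ε / 4 * N) (hn : N ≤ ε / 4 * n) (w : Word n) (τ : Word N)
    (hbad : (Finset.univ.filter (fun i : Fin N =>
      ε / 4 * (n / N : ℕ) ≤ (w.blockLetter (n / N) i (1 - τ i)).card)).card ≤ M)
    (hsmall : ∀ i : Fin N, (w.blockLetter (n / N) i (1 - τ i)).card ≤ n / N) :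
    w.d₁ (τ ∘ blockIndex hN (n / N)) < ε := by
  have hn0 : (0 : ℝ) < n := by exact_mod_cast hN.trans_le hNn
  refine (w.d₁_le_card_ne _).trans_lt ?_
  rw [div_lt_iff₀ hn0]
  set q := n / N with hq
  have hqn : (N : ℝ) * q ≤ n := by exact_mod_cast Nat.mul_div_le n N
  have hterm : ∀ i : Fin N, ((w.blockLetter q i (1 - τ i)).card : ℝ) ≤
      (if ε / 4 * q ≤ (w.blockLetter q i (1 - τ i)).card then (q : ℝ) else 0) + ε / 4 * q := by
    intro i
    have h1 : ((w.blockLetter q i (1 - τ i)).card : ℝ) ≤ q := by exact_mod_cast hsmall i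
    have h2 : 0 ≤ ε / 4 * q := by positivity
    split_ifs with h
    · linarith
    · linarith
  have hsum : ∑ i : Fin N, ((w.blockLetter q i (1 - τ i)).card : ℝ) ≤ M * q + N * (ε / 4 * q) := by
    refine (Finset.sum_le_sum fun i _ => hterm i).trans ?_
    rw [Finset.sum_add_distrib, ← Finset.sum_filter, Finset.sum_const, Finset.sum_const,
      Finset.card_fin, nsmul_eq_mul, nsmul_eq_mul]
    have : ((Finset.univ.filter (fun i : Fin N =>
      ε / 4 * q ≤ (w.blockLetter q i (1 - τ i)).card)).card : ℝ) ≤ M := by exact_mod_cast hbad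
    gcongr
  have hcard : ((Finset.univ.filter (fun p => w p ≠ (τ ∘ blockIndex hN q) p)).card : ℝ)
      ≤ ∑ i : Fin N, ((w.blockLetter q i (1 - τ i)).card : ℝ) + N := by
    exact_mod_cast Word.card_ne_pattern_le hN hNn w τ
  have h1 : (M : ℝ) * q ≤ ε / 4 * (N * q) := by
    calc (M : ℝ) * q ≤ (ε / 4 * N) * q := by gcongr
      _ = _ := by ring
  have h2 : ε / 4 * (N * q) ≤ ε / 4 * n := by gcongr
  have h3 : 0 < ε * n := mul_pos hε hn0
  linarith

/-- Long words far from `P` robustly contain short words outside `P`. -/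
theorem WordProperty.IsHereditary.exists_robustlyContains {P : WordProperty} (hP : P.IsHereditary)
    {ε : ℝ} (hε : 0 < ε) :
    ∃ (L₀ n₀ : ℕ) (c : ℝ), 0 < c ∧ c < 1 ∧ ∀ (n : ℕ) (w : Word n), n₀ ≤ n →
      ENNReal.ofReal ε ≤ w.distTo P →
      ∃ (L : ℕ) (v : Word L), L ≤ L₀ ∧ v ∉ P L ∧ w.RobustlyContains c v := by
  classical
  by_cases hall : ∀ (n : ℕ) (w : Word n), w ∈ P n
  · refine ⟨0, 0, 1 / 2, by norm_num, by norm_num, fun n w _ hw => ?_⟩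
    refine absurd (hall n w) (Word.notMem_of_d₁_lt hw hε ?_)
    simpa [Word.d₁] using hε
  push Not at hall
  obtain ⟨M, u, hu⟩ := hall
  obtain ⟨N, hNM⟩ := exists_nat_ge (max 1 (4 * M / ε))
  have hN1 : (1 : ℝ) ≤ N := (le_max_left _ _).trans hNM
  have hN : 0 < N := by exact_mod_cast hN1
  have hMN : (M : ℝ) ≤ ε / 4 * N := by
    have := (le_max_right _ _).trans hNM
    rw [div_le_iff₀ hε] at this
    linarith
  -- `m τ` is the size of a blow-up of `τ` outside `P`, if there is one
  have hm : ∀ τ : Word N, ∃ m : ℕ, (∃ m', τ.blowUp m' ∉ P (N * m')) → τ.blowUp m ∉ P (N * m) := by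
    intro τ
    by_cases h : ∃ m', τ.blowUp m' ∉ P (N * m')
    · exact ⟨h.choose, fun _ => h.choose_spec⟩
    · exact ⟨0, fun h' => absurd h' h⟩
  choose m hm using hm
  obtain ⟨K, hK0, hK⟩ : ∃ K : ℕ, 0 < K ∧ ∀ τ, m τ ≤ K :=
    ⟨Finset.univ.sup m + 1, Nat.succ_pos _,
      fun τ => (Finset.le_sup (Finset.mem_univ τ)).trans (Nat.le_succ _)⟩
  obtain ⟨n₁, hn₁⟩ := exists_nat_ge (4 * N / ε)
  have hK1 : (1 : ℝ) ≤ K := by exact_mod_cast hK0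
  have hKpos : (0 : ℝ) < 4 * N * K := by positivity
  have hc1 : 1 / (4 * (N : ℝ) * K) < 1 := by
    rw [div_lt_one hKpos]
    nlinarith
  refine ⟨max M (N * K), max n₁ (2 * N * K), min (ε / (8 * N)) (1 / (4 * N * K)),
    lt_min (by positivity) (by positivity), (min_le_right _ _).trans_lt hc1, fun n w hn hw => ?_⟩
  have hnK : 2 * N * K ≤ n := (le_max_right _ _).trans hn
  have hNn : N ≤ n := by nlinarith
  have hnε : (N : ℝ) ≤ ε / 4 * n := by
    have h1 : (n₁ : ℝ) ≤ n := by exact_mod_cast (le_max_left _ _).trans hn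
    have h2 := hn₁.trans h1
    rw [div_le_iff₀ hε] at h2
    linarith
  -- rounding down a number that is at least `1` costs at most a factor `2`
  have hround : ∀ d : ℕ, 0 < d → d ≤ n → (n : ℝ) / (2 * d) ≤ (n / d : ℕ) := by
    intro d hd hdn
    have h1 : 1 ≤ n / d := Nat.div_pos hdn hd
    have h2 : n < d * (n / d + 1) := Nat.lt_mul_div_succ n hd
    have h3 : n ≤ (n / d) * (2 * d) := by nlinarith
    have hd' : (0 : ℝ) < 2 * d := by positivity
    rw [div_le_iff₀ hd']
    exact_mod_cast h3
  have hq0 : 0 < n / N := Nat.div_pos hNn hN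
  have hNq : N * (n / N) ≤ n := Nat.mul_div_le n N
  obtain ⟨τ, hτ⟩ := w.exists_majority hq0 hNq
  by_cases hbad : M ≤ (Finset.univ.filter (fun i : Fin N =>
      ε / 4 * (n / N : ℕ) ≤ (w.blockLetter (n / N) i (1 - τ i)).card)).card
  · refine ⟨M, u, le_max_left _ _, hu, Word.robustlyContains_of_mixed_blocks (q := n / N) w u
      ((Finset.univ.filter (fun i : Fin N => ε / 4 * (n / N : ℕ) ≤
        (w.blockLetter (n / N) i (1 - τ i)).card)).map Fin.valEmbedding)
      (by rwa [Finset.card_map]) fun i hi a => ?_⟩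
    obtain ⟨i, hi', rfl⟩ := Finset.mem_map.1 hi
    have h1 := (Finset.mem_filter.1 hi').2
    have h2 : ((w.blockLetter (n / N) i (1 - τ i)).card : ℝ) ≤ (w.blockLetter (n / N) i a).card := by
      exact_mod_cast (hτ i).2 a
    calc min (ε / (8 * N)) (1 / (4 * N * K)) * (n : ℝ) ≤ ε / (8 * N) * n := by
          gcongr
          exact min_le_left _ _
      _ = ε / 4 * (n / (2 * N)) := by ring
      _ ≤ ε / 4 * (n / N : ℕ) := by
          gcongr
          exact hround N hN hNn
      _ ≤ _ := h1.trans h2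
  · have hclose := w.d₁_pattern_lt hε hN hNn hMN hnε τ (not_le.1 hbad).le (fun i => by
      have h1 := w.card_blockLetter_add hq0 hNq i.2
      have h2 := (hτ i).2 0
      omega)
    have hpat := Word.notMem_of_d₁_lt hw hε hclose
    have hblow : τ.blowUp (m τ) ∉ P (N * m τ) :=
      hm τ ⟨n, fun h => hpat (hP.comp_monotone_mem h _ (blockIndex_monotone hN _))⟩
    refine ⟨_, _, le_max_of_le_right (Nat.mul_le_mul_left _ (hK τ)), hblow,
      Word.robustlyContains_blowUp (q := n / N) (r := n / (2 * N * K)) w τ (fun i => ?_) ?_⟩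
    · have h1 := (hτ i).1
      have h2 : n / (2 * N * K) = n / N / (2 * K) := by
        rw [Nat.div_div_eq_div_mul]
        congr 1
        ring
      have h3 : 2 * K * (n / N / (2 * K)) ≤ n / N := Nat.mul_div_le _ _
      have h4 : m τ * (n / N / (2 * K)) ≤ K * (n / N / (2 * K)) := Nat.mul_le_mul_right _ (hK τ)
      rw [h2]
      nlinarith
    · calc min (ε / (8 * N)) (1 / (4 * N * K)) * (n : ℝ) ≤ 1 / (4 * N * K) * n := by
            gcongr
            exact min_le_right _ _
        _ = n / (2 * (2 * N * K : ℕ)) := by push_cast; ring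
        _ ≤ _ := hround _ (by positivity) hnK

/-! ### Testability -/

theorem WordProperty.IsHereditary.completeness {P : WordProperty} (hP : P.IsHereditary) :
    WordProperty.Completeness 1 P P := by
  classical
  intro n w hw ℓ _ hℓ
  unfold Word.probSub
  rw [Finset.filter_true_of_mem fun I _ => hP n w hw I, div_self]
  rw [Finset.card_powersetCard, Finset.card_fin]
  exact_mod_cast (Nat.choose_pos hℓ).ne'

theorem WordProperty.IsHereditary.soundness {P : WordProperty} (hP : P.IsHereditary) :
    WordProperty.Soundness P P := by
  intro ε hε
  obtain ⟨L₀, n₀, c, hc0, hc1, h⟩ := hP.exists_robustlyContains hε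
  obtain ⟨k, hk⟩ := exists_pow_lt_of_lt_one (show (0 : ℝ) < 1 / (3 * (L₀ + 1)) by positivity)
    (show 1 - c < 1 by linarith)
  refine ⟨max 1 (max n₀ k), le_max_left _ _, fun n w hw ℓ hℓ hℓn => ?_⟩
  have hn₀ : n₀ ≤ n := by omega
  have hkℓ : k ≤ ℓ := by omega
  obtain ⟨L, v, hL, hv, hwv⟩ := h n w hn₀ hw
  have hL' : (L : ℝ) ≤ L₀ + 1 := by exact_mod_cast hL.trans (Nat.le_succ _)
  have hpow : 0 ≤ (1 - c) ^ ℓ := pow_nonneg (by linarith) _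
  calc Word.probSub ℓ w P ≤ L * (1 - c) ^ ℓ := Word.probSub_le_of_robustlyContains hP hwv hv hℓn
    _ ≤ (L₀ + 1) * (1 / (3 * (L₀ + 1))) := by
        gcongr
        exact (pow_le_pow_of_le_one (by linarith) (by linarith) hkℓ).trans hk.le
    _ = 1 / 3 := by field_simp

theorem theorem4 (P : WordProperty) (hP : WordProperty.IsHereditary P) :
    WordProperty.IsTestableWithPerfectCompleteness P := by
  exact ⟨P, hP.completeness, hP.soundness⟩
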